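/- **Setting.** Let $\Omega=\{(x,y)\in\mathbb{R}^2 : x<y\}$, let $\partial\Omega$ be the diagonal and $\overline\Omega=\Omega\cup\partial\Omega$. For a finite set $S\subset\mathbb{R}^m$ and $\varepsilon\in\mathbb{R}$ let $\mathrm{VR}(S,\varepsilon)$ be the Vietoris–Rips complex, whose simplices are the nonempty subsets of $S$ of (Euclidean) diameter less than $\varepsilon$. For a field $\mathbb{k}$ and an integer $k\ge 0$, the persistence diagram of $S$ in homology dimension $k$, regarded as a measure on $\Omega$, is $D[S]=\sum_{x\in\Omega} n_x\delta_x$, where $n_{(s,t)}$ is the multiplicity of the birth–death pair $(s,t)$ in the persistence module $(H_k(\mathrm{VR}(S,\varepsilon);\mathbb{k}))_{\varepsilon\in\mathbb{R}}$; only pairs with finite death time $t$ are counted. For measures $\mu,\nu$ on $\Omega$ and $1\le p<\infty$, let $$\mathrm{OT}_p(\mu,\nu)=\inf_{\Gamma}\Big(\int_{\overline\Omega\times\overline\Omega}\|x-y\|_p^p\,d\Gamma(x,y)\Big)^{1/p},$$ the infimum being over all Radon measures $\Gamma$ on $\overline\Omega\times\overline\Omega$ with $\Gamma(P\times\overline\Omega)=\mu(P)$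 and $\Gamma(\overline\Omega\times Q)=\nu(Q)$ for all Borel sets $P,Q\subseteq\Omega$. **Statement.** Let $\mathcal{X}\subset\mathbb{R}^m$ be a finite set and let $1\le p<\infty$. There is a constant $C(\mathcal{X},p)>0$, depending only on $\mathcal{X}$ and $p$, such that the following holds for every field $\mathbb{k}$, every homology dimension $k\ge0$, every probability measure $\pi$ on $\mathcal{X}$ and all integers $n,B\ge 1$. Let $S_n^{(1)},\dots,S_n^{(B)}$ be independent samples, each consisting of $n$ i.i.d. points of $\mathcal{X}$ with law $\pi$ (that is, each with law $\pi^{\otimes n}$, and viewed as a subset of $\mathcal{X}$ when its diagram is taken). Let $$\bar D=\frac1B\sum_{i=1}^B D[S_n^{(i)}]$$ be the mean persistence measure, and let $D_\mu$ be the expected persistence diagram, i.e. the measure on $\Omega$ with $D_\mu(A)=\mathbb{E}_{S\sim\pi^{\otimes n}}\big[D[S](A)\big]$ for every Borel set $A\subseteq\Omega$. Then $$\mathbb{E}\big[\mathrm{OT}_p^p(\bar D,D_\mu)\big]\le\frac{C(\mathcal{X},p)}{\sqrt B}.$$ -/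

import Mathlib

set_option maxSynthPendingDepth 3

open MeasureTheory ProbabilityTheory
open scoped ENNReal

noncomputable section

/-! ### Simplicial homology with field coefficients -/

section Homology

variable (𝕜 : Type*) [Field 𝕜] {V : Type*}

/-- The `k`-chains of `K`. -/
def simplicialChains (K : PreAbstractSimplicialComplex V) (k : ℕ) : Submodule 𝕜 (Finset V →₀ 𝕜) :=
  Finsupp.supported 𝕜 𝕜 {σ | σ ∈ K.faces ∧ σ.card = k + 1}

lemma simplicialChains_mono {K L : PreAbstractSimplicialComplex V} (h : K ≤ L) (k : ℕ) :
    simplicialChains 𝕜 K k ≤ simplicialChains 𝕜 L k :=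
  Finsupp.supported_mono fun _ hσ => ⟨h hσ.1, hσ.2⟩

variable [LinearOrder V]

/-- The simplicial boundary operator. A simplex is a finite set of vertices, oriented by the order
of the vertices, and the face omitting `v` carries the sign `(-1) ^ #{w ∈ σ | w < v}`. Vertices have
boundary `0` (unreduced homology). -/
def simplicialBoundary : (Finset V →₀ 𝕜) →ₗ[𝕜] (Finset V →₀ 𝕜) :=
  Finsupp.linearCombination 𝕜 fun σ : Finset V =>
    if 2 ≤ σ.card then
      ∑ v ∈ σ, Finsupp.single (σ.erase v) ((-1 : 𝕜) ^ (σ.filter (· < v)).card)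
    else 0

/-- The `k`-cycles of `K`. -/
def simplicialCycles (K : PreAbstractSimplicialComplex V) (k : ℕ) : Submodule 𝕜 (Finset V →₀ 𝕜) :=
  simplicialChains 𝕜 K k ⊓ LinearMap.ker (simplicialBoundary 𝕜)

/-- The `k`-boundaries of `K`. -/
def simplicialBoundaries (K : PreAbstractSimplicialComplex V) (k : ℕ) :
    Submodule 𝕜 (Finset V →₀ 𝕜) :=
  (simplicialChains 𝕜 K (k + 1)).map (simplicialBoundary 𝕜)

/-- The `k`-th simplicial homology of `K` with coefficients in `𝕜`. -/
abbrev SimplicialHomology (K : PreAbstractSimplicialComplex V) (k : ℕ) : Type _ :=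
  simplicialCycles 𝕜 K k ⧸ (simplicialBoundaries 𝕜 K k).submoduleOf (simplicialCycles 𝕜 K k)

lemma simplicialCycles_mono {K L : PreAbstractSimplicialComplex V} (h : K ≤ L) (k : ℕ) :
    simplicialCycles 𝕜 K k ≤ simplicialCycles 𝕜 L k :=
  inf_le_inf_right _ (simplicialChains_mono 𝕜 h k)

/-- The map in homology induced by the inclusion of a subcomplex. -/
def simplicialHomologyMap {K L : PreAbstractSimplicialComplex V} (h : K ≤ L) (k : ℕ) :
    SimplicialHomology 𝕜 K k →ₗ[𝕜] SimplicialHomology 𝕜 L k :=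
  Submodule.mapQ _ _ (Submodule.inclusion (simplicialCycles_mono 𝕜 h k)) fun _ hx =>
    Submodule.map_mono (simplicialChains_mono 𝕜 h (k + 1)) hx

end Homology

/-! ### The Vietoris–Rips filtration and its persistence diagram -/

/-- The Vietoris–Rips complex of `S` at scale `ε`: all nonempty finite subsets of `S` of diameter
less than `ε`. -/
def vietorisRips {V : Type*} [PseudoMetricSpace V] (S : Set V) (ε : ℝ) :
    PreAbstractSimplicialComplex V where
  faces := {σ | σ.Nonempty ∧ (σ : Set V) ⊆ S ∧ Metric.diam (σ : Set V) < ε}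
  isRelLowerSet_faces := fun {_} hσ => ⟨hσ.1, fun _ hτ hne =>
    ⟨hne, (Finset.coe_subset.2 hτ).trans hσ.2.1,
      (Metric.diam_mono (Finset.coe_subset.2 hτ) (Finset.finite_toSet _).isBounded).trans_lt
        hσ.2.2⟩⟩

lemma vietorisRips_mono {V : Type*} [PseudoMetricSpace V] (S : Set V) {ε ε' : ℝ} (h : ε ≤ ε') :
    vietorisRips S ε ≤ vietorisRips S ε' :=
  fun _ hσ => ⟨hσ.1, hσ.2.1, hσ.2.2.trans_le h⟩

/-- The lexicographic order on `ℝ^m`, used only to orient simplices. -/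
abbrev euclideanLex (m : ℕ) : LinearOrder (EuclideanSpace ℝ (Fin m)) :=
  LinearOrder.lift' (fun x => toLex (WithLp.ofLp x))
    (fun _ _ h => WithLp.ofLp_injective 2 (toLex.injective h))

/-- The open half-plane `Ω` above the diagonal. -/
abbrev HalfPlane : Type := {x : ℝ × ℝ // x.1 < x.2}

/-- The closed half-plane: `Ω` together with the diagonal. -/
abbrev ClosedHalfPlane : Type := {x : ℝ × ℝ // x.1 ≤ x.2}

section Diagram

attribute [local instance] euclideanLex

variable (𝕜 : Type*) [Field 𝕜] {m : ℕ} (k : ℕ) (S : Set (EuclideanSpace ℝ (Fin m)))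

/-- For `a ≤ b ≤ t`: the classes in `H_k` at scale `b` whose image at scale `t` comes from a class
at scale `a`. -/
def deadClasses {a b t : ℝ} (hab : a ≤ b) (hbt : b ≤ t) :
    Submodule 𝕜 (SimplicialHomology 𝕜 (vietorisRips S b) k) :=
  (LinearMap.range (simplicialHomologyMap 𝕜 (vietorisRips_mono S (hab.trans hbt)) k)).comap
    (simplicialHomologyMap 𝕜 (vietorisRips_mono S hbt) k)

/-- For `a ≤ b ≤ c ≤ d`: the number of independent `k`-dimensional homology classes of the
Vietoris–Rips filtration of `S` that are born between the scales `a` and `b` and die between the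
scales `c` and `d`. -/
def birthDeathCount {a b c d : ℝ} (hab : a ≤ b) (hbc : b ≤ c) (hcd : c ≤ d) : ℕ :=
  Module.finrank 𝕜 (deadClasses 𝕜 k S hab (hbc.trans hcd) ⧸
    (deadClasses 𝕜 k S hab hbc).submoduleOf (deadClasses 𝕜 k S hab (hbc.trans hcd)))

/-- The multiplicity of the off-diagonal point `x` in the persistence diagram: the smallest
`birthDeathCount` over the rectangles `[a, b] × [c, d]` around `x`. -/
def diagramMultiplicity (x : HalfPlane) : ℕ :=
  sInf {r | ∃ (a b c d : ℝ) (hab : a ≤ b) (hbc : b ≤ c) (hcd : c ≤ d),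
    a < x.1.1 ∧ x.1.1 < b ∧ c < x.1.2 ∧ x.1.2 < d ∧ r = birthDeathCount 𝕜 k S hab hbc hcd}

/-- The persistence diagram `D[S]` of the Vietoris–Rips filtration of `S` in homology dimension `k`,
as the measure `∑ n_x δ_x` on `Ω`. -/
def persistenceDiagram : Measure HalfPlane :=
  Measure.sum fun x : HalfPlane => (diagramMultiplicity 𝕜 k S x : ℝ≥0∞) • Measure.dirac x

end Diagram

/-! ### Optimal partial transport -/

/-- `Γ` is an admissible transport plan between `μ` and `ν`: a Radon measure on pairs of points of
the closed half-plane whose marginals agree with `μ` and `ν` off the diagonal. -/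
structure IsAdmissiblePlan (μ ν : Measure HalfPlane)
    (Γ : Measure (ClosedHalfPlane × ClosedHalfPlane)) : Prop where
  radon : Γ.Regular
  fst_eq : ∀ P : Set HalfPlane, MeasurableSet P →
    Γ {z | ∃ x ∈ P, z.1.1 = x.1} = μ P
  snd_eq : ∀ Q : Set HalfPlane, MeasurableSet Q →
    Γ {z | ∃ y ∈ Q, z.2.1 = y.1} = ν Q

/-- The optimal partial transport distance `OT_{p,q}`, with the `q`-norm on the plane as ground
norm. -/
def OTDist (p : ℝ) (q : ℝ≥0∞) (μ ν : Measure HalfPlane) : ℝ≥0∞ :=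
  ⨅ (Γ : Measure (ClosedHalfPlane × ClosedHalfPlane)) (_ : IsAdmissiblePlan μ ν Γ),
    (∫⁻ z, ENNReal.ofReal (‖WithLp.toLp q (z.1.1 - z.2.1)‖ ^ p) ∂Γ) ^ (1 / p)

/-! ### Subsampling -/

section Subsampling

variable (𝕜 : Type*) [Field 𝕜] (k : ℕ) {m : ℕ} {X : Finset (EuclideanSpace ℝ (Fin m))}

/-- The persistence diagram of the subset of `X` formed by the points `s 0, …, s (n - 1)`. -/
def sampleDiagram {n : ℕ} (s : Fin n → X) : Measure HalfPlane :=
  persistenceDiagram 𝕜 k (Set.range fun i => (s i : EuclideanSpace ℝ (Fin m)))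

/-- The mean persistence measure of the diagrams of `B` subsamples. -/
def meanDiagram {n B : ℕ} (s : Fin B → Fin n → X) : Measure HalfPlane :=
  (B : ℝ≥0∞)⁻¹ • ∑ i, sampleDiagram 𝕜 k (s i)

/-- The expected persistence diagram of `n` independent points of `X` with law `π`. -/
def expectedDiagram (π : Measure X) (n : ℕ) : Measure HalfPlane :=
  (Measure.pi fun _ : Fin n => π).bind (sampleDiagram 𝕜 k)

lemma expectedDiagram_apply (π : Measure X) (n : ℕ) {A : Set HalfPlane} (hA : MeasurableSet A) :
    expectedDiagram 𝕜 k π n A =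
      ∫⁻ s, sampleDiagram 𝕜 k s A ∂(Measure.pi fun _ : Fin n => π) :=
  Measure.bind_apply hA (Measurable.of_discrete).aemeasurable

end Subsampling

end

/-! ### Finiteness of Vietoris–Rips persistence diagrams -/

section HomologyMaps

variable (𝕜 : Type*) [Field 𝕜] {V : Type*} [LinearOrder V]

/-! A subset of `X` has a Vietoris–Rips filtration that changes only at diameters of subsets of `X`.
Hence the diagrams of all samples live on one finite set of atoms, `criticalPairs X`, with
multiplicities at most `2 ^ X.card`, whatever the field, degree, law or sample size.

The mean and expected diagrams are therefore weighted sums over the same atoms. Keeping common mass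
in place and sending the excess to the diagonal (`OTDist_rpow_le`) bounds the transport cost by a
fixed weighted sum of the absolute differences of the weights. At each atom this difference is the
deviation of an empirical mean of `B` independent bounded variables from its expectation, of order
`1 / √B` in mean by a variance estimate (`lintegral_abs_mean_sub_le`). -/

lemma simplicialHomologyMap_comp {K L M : PreAbstractSimplicialComplex V} (h : K ≤ L) (h' : L ≤ M)
    (k : ℕ) (z : SimplicialHomology 𝕜 K k) :
    simplicialHomologyMap 𝕜 h' k (simplicialHomologyMap 𝕜 h k z) =
      simplicialHomologyMap 𝕜 (h.trans h') k z := by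
  induction z using Submodule.Quotient.induction_on with
  | H z => rfl

lemma simplicialHomologyMap_surjective {K L : PreAbstractSimplicialComplex V} (h : K ≤ L)
    (h' : L ≤ K) (k : ℕ) : Function.Surjective (simplicialHomologyMap 𝕜 h k) := fun z =>
  ⟨simplicialHomologyMap 𝕜 h' k z, by
    rw [simplicialHomologyMap_comp]
    induction z using Submodule.Quotient.induction_on with
    | H z => rfl⟩

lemma simplicialHomologyMap_injective {K L : PreAbstractSimplicialComplex V} (h : K ≤ L)
    (h' : L ≤ K) (k : ℕ) : Function.Injective (simplicialHomologyMap 𝕜 h k) :=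
  Function.LeftInverse.injective (g := simplicialHomologyMap 𝕜 h' k) fun z => by
    rw [simplicialHomologyMap_comp]
    induction z using Submodule.Quotient.induction_on with
    | H z => rfl

variable {K : PreAbstractSimplicialComplex V} {A : Finset V}

/-- Homology is a quotient of a space of cycles inside the span of the simplices, and there are at
most `2 ^ A.card` of these. The bound does not involve `𝕜` or `k`. -/
lemma finite_simplicialHomology_and_finrank_le (hK : ∀ σ ∈ K.faces, σ ⊆ A) (k : ℕ) :
    Module.Finite 𝕜 (SimplicialHomology 𝕜 K k) ∧
      Module.finrank 𝕜 (SimplicialHomology 𝕜 K k) ≤ 2 ^ A.card := by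
  set s : Set (Finset V) := {σ | σ ∈ K.faces ∧ σ.card = k + 1} with hs
  have hsub : s ⊆ (A.powerset : Set (Finset V)) := fun σ hσ => by
    simpa using hK σ hσ.1
  have hfin : s.Finite := A.powerset.finite_toSet.subset hsub
  have : Fintype s := hfin.fintype
  let e := Finsupp.supportedEquivFinsupp (R := 𝕜) (M := 𝕜) s
  have hchain : Module.Finite 𝕜 (simplicialChains 𝕜 K k) := Module.Finite.equiv e.symm
  have hrank : Module.finrank 𝕜 (simplicialChains 𝕜 K k) ≤ 2 ^ A.card := by
    rw [← Finset.card_powerset]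
    calc Module.finrank 𝕜 (simplicialChains 𝕜 K k) = Module.finrank 𝕜 (s →₀ 𝕜) := e.finrank_eq
      _ = Fintype.card s := Module.finrank_finsupp_self 𝕜
      _ = s.toFinset.card := s.toFinset_card.symm
      _ ≤ A.powerset.card := Finset.card_le_card fun σ hσ => by
        simpa using hsub (Set.mem_toFinset.1 hσ)
  have hle : simplicialCycles 𝕜 K k ≤ simplicialChains 𝕜 K k := inf_le_left
  have hcycle : Module.Finite 𝕜 (simplicialCycles 𝕜 K k) :=
    Submodule.finiteDimensional_of_le hle
  exact ⟨inferInstance,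
    (Submodule.finrank_quotient_le _).trans ((Submodule.finrank_mono hle).trans hrank)⟩

end HomologyMaps

section Diagram

attribute [local instance] euclideanLex

variable (𝕜 : Type*) [Field 𝕜] {m : ℕ} (k : ℕ) {S : Set (EuclideanSpace ℝ (Fin m))}
  {X : Finset (EuclideanSpace ℝ (Fin m))}

lemma birthDeathCount_le (hS : S ⊆ X) {a b c d : ℝ} (hab : a ≤ b) (hbc : b ≤ c) (hcd : c ≤ d) :
    birthDeathCount 𝕜 k S hab hbc hcd ≤ 2 ^ X.card := by
  obtain ⟨hfin, hrank⟩ := finite_simplicialHomology_and_finrank_le 𝕜 (K := vietorisRips S b)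
    (A := X) (fun σ hσ => Finset.coe_subset.1 (hσ.2.1.trans hS)) k
  exact (Submodule.finrank_quotient_le _).trans ((Submodule.finrank_le _).trans hrank)

lemma birthDeathCount_eq_zero_of_le {a b c d : ℝ} (hab : a ≤ b) (hbc : b ≤ c) (hcd : c ≤ d)
    (h : deadClasses 𝕜 k S hab (hbc.trans hcd) ≤ deadClasses 𝕜 k S hab hbc) :
    birthDeathCount 𝕜 k S hab hbc hcd = 0 := by
  have := Submodule.Quotient.subsingleton_iff.2 (Submodule.submoduleOf_eq_top.2 h)
  exact Module.finrank_zero_of_subsingleton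

/-- When nothing changes between `a` and `b`, every class at `b` comes from `a`, so it already
counts as dead at `c`. -/
lemma birthDeathCount_eq_zero_of_birth {a b c d : ℝ} (hab : a ≤ b) (hbc : b ≤ c) (hcd : c ≤ d)
    (h : vietorisRips S b ≤ vietorisRips S a) : birthDeathCount 𝕜 k S hab hbc hcd = 0 := by
  refine birthDeathCount_eq_zero_of_le 𝕜 k hab hbc hcd fun z _ => ?_
  obtain ⟨w, rfl⟩ := simplicialHomologyMap_surjective 𝕜 (vietorisRips_mono S hab) h k z
  exact ⟨w, (simplicialHomologyMap_comp 𝕜 _ _ k w).symm⟩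

/-- The map from scale `c` to scale `d` is injective, so a coincidence of images seen at `d` already
holds at `c`. -/
lemma birthDeathCount_eq_zero_of_death {a b c d : ℝ} (hab : a ≤ b) (hbc : b ≤ c) (hcd : c ≤ d)
    (h : vietorisRips S d ≤ vietorisRips S c) : birthDeathCount 𝕜 k S hab hbc hcd = 0 := by
  refine birthDeathCount_eq_zero_of_le 𝕜 k hab hbc hcd fun z hz => ?_
  obtain ⟨w, hw⟩ := hz
  refine ⟨w, simplicialHomologyMap_injective 𝕜 (vietorisRips_mono S hcd) h k ?_⟩
  rw [simplicialHomologyMap_comp, simplicialHomologyMap_comp]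
  exact hw

lemma diagramMultiplicity_le_birthDeathCount (x : HalfPlane) {a b c d : ℝ} (hab : a ≤ b)
    (hbc : b ≤ c) (hcd : c ≤ d) (ha : a < x.1.1) (hb : x.1.1 < b) (hc : c < x.1.2)
    (hd : x.1.2 < d) : diagramMultiplicity 𝕜 k S x ≤ birthDeathCount 𝕜 k S hab hbc hcd :=
  Nat.sInf_le ⟨a, b, c, d, hab, hbc, hcd, ha, hb, hc, hd, rfl⟩

lemma diagramMultiplicity_le (hS : S ⊆ X) (x : HalfPlane) :
    diagramMultiplicity 𝕜 k S x ≤ 2 ^ X.card := by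
  obtain ⟨b, hb, hb'⟩ := exists_between x.2
  obtain ⟨c, hc, hc'⟩ := exists_between hb'
  exact (diagramMultiplicity_le_birthDeathCount 𝕜 k x (a := x.1.1 - 1) (d := x.1.2 + 1)
    (by linarith) hc.le (by linarith) (by linarith) hb hc' (by linarith)).trans
    (birthDeathCount_le 𝕜 k hS _ _ _)

/-- The scales at which the Vietoris–Rips filtration of a subset of `X` can change. -/
noncomputable def criticalScales (X : Finset (EuclideanSpace ℝ (Fin m))) : Finset ℝ :=
  X.powerset.image fun σ : Finset _ => Metric.diam (σ : Set (EuclideanSpace ℝ (Fin m)))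

lemma vietorisRips_le_of_disjoint_criticalScales (hS : S ⊆ X) {a b : ℝ}
    (h : ∀ r ∈ criticalScales X, r < b → r < a) : vietorisRips S b ≤ vietorisRips S a :=
  fun _ hσ => ⟨hσ.1, hσ.2.1, h _ (Finset.mem_image_of_mem _
    (Finset.mem_powerset.2 (Finset.coe_subset.1 (hσ.2.1.trans hS)))) hσ.2.2⟩

/-- A finite set is closed, so a point outside it has a neighbourhood avoiding it. The outer bounds
`u`, `v` allow the interval to stay on one side of a separating scale. -/
lemma exists_Ioo_forall_notMem (T : Finset ℝ) {s : ℝ} (hs : s ∉ T) {u v : ℝ} (hu : u < s)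
    (hv : s < v) : ∃ a b, u < a ∧ a < s ∧ s < b ∧ b < v ∧ ∀ r ∈ T, r < b → r < a := by
  have hmem : (T : Set ℝ)ᶜ ∈ nhds s := T.finite_toSet.isClosed.isOpen_compl.mem_nhds hs
  obtain ⟨l, r, ⟨hl, hr⟩, hlr⟩ := mem_nhds_iff_exists_Ioo_subset.1 hmem
  obtain ⟨a, ha, ha'⟩ := exists_between (max_lt hu hl)
  obtain ⟨b, hb, hb'⟩ := exists_between (lt_min hv hr)
  refine ⟨a, b, (le_max_left _ _).trans_lt ha, ha', hb, hb'.trans_le (min_le_left _ _),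
    fun q hq hqb => lt_of_not_ge fun haq => hlr ⟨?_, ?_⟩ hq⟩
  · exact ((le_max_right _ _).trans_lt ha).trans_le haq
  · exact hqb.trans (hb'.trans_le (min_le_right _ _))

/-- The points of the half-plane both of whose coordinates are critical scales of `X`. -/
noncomputable def criticalPairs (X : Finset (EuclideanSpace ℝ (Fin m))) : Finset HalfPlane :=
  (criticalScales X ×ˢ criticalScales X).subtype fun x => x.1 < x.2

lemma diagramMultiplicity_eq_zero (hS : S ⊆ X) {x : HalfPlane} (hx : x ∉ criticalPairs X) :
    diagramMultiplicity 𝕜 k S x = 0 := by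
  have hx' : x.1.1 ∉ criticalScales X ∨ x.1.2 ∉ criticalScales X := by
    by_contra! h
    exact hx (Finset.mem_subtype.2 (Finset.mem_product.2 h))
  -- The scale `q` separates birth from death: it serves as `c` when the birth coordinate is not
  -- critical and as `b` when the death coordinate is not.
  obtain ⟨q, hq, hq'⟩ := exists_between x.2
  rw [← Nat.le_zero]
  rcases hx' with h | h
  · obtain ⟨a, b, -, ha, hb, hbq, hT⟩ :=
      exists_Ioo_forall_notMem _ h (sub_one_lt x.1.1) hq
    exact (diagramMultiplicity_le_birthDeathCount 𝕜 k x (d := x.1.2 + 1) (ha.trans hb).le hbq.le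
      (by linarith) ha hb hq' (by linarith)).trans (birthDeathCount_eq_zero_of_birth 𝕜 k _ _ _
        (vietorisRips_le_of_disjoint_criticalScales hS hT)).le
  · obtain ⟨c, d, hqc, hc, hd, -, hT⟩ :=
      exists_Ioo_forall_notMem _ h hq' (lt_add_one x.1.2)
    exact (diagramMultiplicity_le_birthDeathCount 𝕜 k x (a := x.1.1 - 1) (by linarith) hqc.le
      (hc.trans hd).le (by linarith) hq hc hd).trans (birthDeathCount_eq_zero_of_death 𝕜 k _ _ _
        (vietorisRips_le_of_disjoint_criticalScales hS hT)).le

lemma persistenceDiagram_eq_sum (hS : S ⊆ X) :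
    persistenceDiagram 𝕜 k S =
      ∑ x ∈ criticalPairs X, (diagramMultiplicity 𝕜 k S x : ℝ≥0∞) • Measure.dirac x := by
  ext A hA
  rw [persistenceDiagram, Measure.sum_apply _ hA, Measure.finsetSum_apply]
  exact tsum_eq_sum fun x hx => by simp [diagramMultiplicity_eq_zero 𝕜 k hS hx]

end Diagram

/-! ### Transport of finitely supported measures through the diagonal -/

/-- The inclusion of the open half-plane into the closed one. -/
def HalfPlane.toClosed (x : HalfPlane) : ClosedHalfPlane := ⟨x.1, x.2.le⟩

/-- The vertical projection of the half-plane to the diagonal. -/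
def HalfPlane.toDiagonal (x : HalfPlane) : ClosedHalfPlane := ⟨(x.1.1, x.1.1), le_rfl⟩

lemma ClosedHalfPlane.regular_of_isFiniteMeasure
    (Γ : Measure (ClosedHalfPlane × ClosedHalfPlane)) [IsFiniteMeasure Γ] : Γ.Regular := by
  have hc : IsClosed {x : ℝ × ℝ | x.1 ≤ x.2} := isClosed_le continuous_fst continuous_snd
  have : SigmaCompactSpace ClosedHalfPlane := hc.isClosedEmbedding_subtypeVal.sigmaCompactSpace
  infer_instance

lemma HalfPlane.toClosed_mem (x : HalfPlane) (P : Set HalfPlane) :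
    (∃ y ∈ P, x.toClosed.1 = y.1) ↔ x ∈ P := by
  constructor
  · rintro ⟨y, hy, h⟩
    have hxy : x = y := Subtype.ext h
    rwa [hxy]
  · exact fun h => ⟨x, h, rfl⟩

lemma HalfPlane.toDiagonal_notMem (x : HalfPlane) (P : Set HalfPlane) :
    ¬ ∃ y ∈ P, x.toDiagonal.1 = y.1 := by
  rintro ⟨y, -, h⟩
  have := y.2
  rw [← h] at this
  exact lt_irrefl _ this

/-- The plan that keeps the common mass of `∑ a x δ_x` and `∑ b x δ_x` in place and moves the
excess vertically to the diagonal. -/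
noncomputable def diagonalPlan (F : Finset HalfPlane) (a b : HalfPlane → ℝ≥0∞) :
    Measure (ClosedHalfPlane × ClosedHalfPlane) :=
  ∑ x ∈ F, (min (a x) (b x) • Measure.dirac (x.toClosed, x.toClosed) +
    ((a x - b x) • Measure.dirac (x.toClosed, x.toDiagonal) +
      (b x - a x) • Measure.dirac (x.toDiagonal, x.toClosed)))

/-- Mass on the diagonal is invisible to the marginal conditions, so each atom only needs `min (a x)
(b x)` plus a truncated difference to recover its weight. -/
lemma isAdmissiblePlan_diagonalPlan (F : Finset HalfPlane) {a b : HalfPlane → ℝ≥0∞}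
    (ha : ∀ x ∈ F, a x ≠ ∞) (hb : ∀ x ∈ F, b x ≠ ∞) :
    IsAdmissiblePlan (∑ x ∈ F, a x • Measure.dirac x) (∑ x ∈ F, b x • Measure.dirac x)
      (diagonalPlan F a b) where
  radon := by
    have : IsFiniteMeasure (diagonalPlan F a b) := ⟨by
      rw [diagonalPlan, Measure.finsetSum_apply, ENNReal.sum_lt_top]
      intro x hx
      have h1 : min (a x) (b x) < ∞ := (min_le_left _ _).trans_lt (ha x hx).lt_top
      have h2 : a x - b x < ∞ := tsub_le_self.trans_lt (ha x hx).lt_top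
      have h3 : b x - a x < ∞ := tsub_le_self.trans_lt (hb x hx).lt_top
      simp [h1, h2, h3]⟩
    exact ClosedHalfPlane.regular_of_isFiniteMeasure _
  fst_eq P _ := by
    rw [diagonalPlan, Measure.finsetSum_apply, Measure.finsetSum_apply]
    refine Finset.sum_congr rfl fun x _ => ?_
    have h : min (a x) (b x) + (a x - b x) = a x := by
      rw [add_comm, tsub_add_min]
    by_cases hx : x ∈ P <;>
      simp [Measure.dirac_apply, Set.indicator, HalfPlane.toClosed_mem,
        HalfPlane.toDiagonal_notMem, hx, h, -Subtype.exists]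
  snd_eq Q _ := by
    rw [diagonalPlan, Measure.finsetSum_apply, Measure.finsetSum_apply]
    refine Finset.sum_congr rfl fun x _ => ?_
    have h : min (a x) (b x) + (b x - a x) = b x := by
      rw [add_comm, min_comm, tsub_add_min]
    by_cases hx : x ∈ Q <;>
      simp [Measure.dirac_apply, Set.indicator, HalfPlane.toClosed_mem,
        HalfPlane.toDiagonal_notMem, hx, h, -Subtype.exists]

/-- The `p`-th power of the distance in the `p`-norm from `x` to its vertical projection to the
diagonal. -/
noncomputable def diagonalCost (p : ℝ) (x : HalfPlane) : ℝ :=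
  ‖WithLp.toLp (ENNReal.ofReal p) (x.1 - (x.1.1, x.1.1))‖ ^ p

lemma diagonalCost_nonneg {p : ℝ} (hp : 1 ≤ p) (x : HalfPlane) : 0 ≤ diagonalCost p x := by
  have : Fact (1 ≤ ENNReal.ofReal p) := ⟨by simpa using hp⟩
  exact Real.rpow_nonneg (norm_nonneg _) _

lemma OTDist_rpow_le {p : ℝ} (hp : 1 ≤ p) (F : Finset HalfPlane) {a b : HalfPlane → ℝ≥0∞}
    (ha : ∀ x ∈ F, a x ≠ ∞) (hb : ∀ x ∈ F, b x ≠ ∞) :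
    OTDist p (ENNReal.ofReal p) (∑ x ∈ F, a x • Measure.dirac x)
        (∑ x ∈ F, b x • Measure.dirac x) ^ p ≤
      ∑ x ∈ F, ENNReal.ofReal (diagonalCost p x) * ((a x - b x) + (b x - a x)) := by
  have hp0 : 0 < p := one_pos.trans_le hp
  have : Fact (1 ≤ ENNReal.ofReal p) := ⟨by simpa using hp⟩
  have hle : OTDist p (ENNReal.ofReal p) (∑ x ∈ F, a x • Measure.dirac x)
      (∑ x ∈ F, b x • Measure.dirac x) ≤ _ :=
    iInf₂_le _ (isAdmissiblePlan_diagonalPlan F ha hb)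
  refine (ENNReal.rpow_le_rpow hle hp0.le).trans ?_
  rw [← ENNReal.rpow_mul, one_div_mul_cancel hp0.ne', ENNReal.rpow_one, diagonalPlan,
    lintegral_finsetSum_measure]
  refine Finset.sum_le_sum fun x _ => le_of_eq ?_
  have hsymm : ‖WithLp.toLp (ENNReal.ofReal p) (x.toDiagonal.1 - x.toClosed.1)‖ ^ p =
      diagonalCost p x := by
    rw [diagonalCost, ← norm_neg, ← WithLp.toLp_neg, neg_sub]
    rfl
  have hdir : ‖WithLp.toLp (ENNReal.ofReal p) (x.toClosed.1 - x.toDiagonal.1)‖ ^ p =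
      diagonalCost p x := rfl
  simp only [lintegral_add_measure, lintegral_smul_measure, lintegral_dirac, hsymm, hdir, sub_self,
    WithLp.toLp_zero, norm_zero, Real.zero_rpow hp0.ne', smul_eq_mul, ENNReal.ofReal_zero]
  ring

/-! ### Mean absolute deviation of an empirical mean -/

/-- Subtraction in `ℝ≥0∞` truncates at zero, so at most one summand survives. -/
lemma ENNReal.sub_add_sub_eq_ofReal_abs {u v : ℝ} (hu : 0 ≤ u) (hv : 0 ≤ v) :
    (ENNReal.ofReal u - ENNReal.ofReal v) + (ENNReal.ofReal v - ENNReal.ofReal u) =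
      ENNReal.ofReal |u - v| := by
  rw [← ENNReal.ofReal_sub _ hv, ← ENNReal.ofReal_sub _ hu]
  rcases le_total u v with h | h
  · rw [ENNReal.ofReal_of_nonpos (sub_nonpos.2 h), abs_of_nonpos (sub_nonpos.2 h), zero_add,
      neg_sub]
  · rw [ENNReal.ofReal_of_nonpos (sub_nonpos.2 h), abs_of_nonneg (sub_nonneg.2 h), add_zero]

/-- The empirical mean of `B` independent random variables with values in `[0, N]` and common
expectation `e` deviates from `e` by `O(1 / √B)` in mean. -/
lemma lintegral_abs_mean_sub_le {Ω : Type*} [MeasurableSpace Ω] {P : Measure Ω}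
    [IsProbabilityMeasure P] {B : ℕ} (hB : 0 < B) {Y : Fin B → Ω → ℝ} {N e : ℝ}
    (hY : ∀ i, AEMeasurable (Y i) P) (hbound : ∀ i ω, Y i ω ∈ Set.Icc 0 N)
    (hmean : ∀ i, ∫ ω, Y i ω ∂P = e) (hindep : iIndepFun Y P) :
    ∫⁻ ω, ENNReal.ofReal |(B : ℝ)⁻¹ * ∑ i, Y i ω - e| ∂P ≤
      ENNReal.ofReal ((N ^ 2 + 1) / √B) := by
  have hB' : (0 : ℝ) < B := Nat.cast_pos.2 hB
  have hs : 0 < √(B : ℝ) := Real.sqrt_pos.2 hB'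
  have hss : √(B : ℝ) * √B = B := Real.mul_self_sqrt hB'.le
  have hLp (i) : MemLp (Y i) 2 P := memLp_of_bounded (ae_of_all _ (hbound i))
    (hY i).aestronglyMeasurable 2
  have hsum : MemLp (fun ω => ∑ i, Y i ω) 2 P := memLp_finsetSum _ fun i _ => hLp i
  set Z : Ω → ℝ := fun ω => (B : ℝ)⁻¹ * ∑ i, Y i ω with hZ
  have hZLp : MemLp Z 2 P := hsum.const_mul _
  have hZmean : ∫ ω, Z ω ∂P = e := by
    rw [hZ, integral_const_mul, integral_finsetSum _ fun i _ => (hLp i).integrable one_le_two]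
    simp [hmean, hB'.ne']
  have hvar : Var[Z; P] ≤ N ^ 2 / B := by
    have h1 : Var[∑ i, Y i; P] = ∑ i, Var[Y i; P] :=
      IndepFun.variance_sum (fun i _ => hLp i) fun i _ j _ hij => hindep.indepFun hij
    have h2 (i) : Var[Y i; P] ≤ N ^ 2 :=
      (variance_le_sq_of_bounded (ae_of_all _ (hbound i)) (hY i)).trans (by nlinarith [sq_nonneg N])
    have h3 : (fun ω => ∑ i, Y i ω) = ∑ i, Y i := by ext; simp
    rw [hZ, variance_const_mul, h3, h1]
    calc ((B : ℝ)⁻¹) ^ 2 * ∑ i, Var[Y i; P] ≤ ((B : ℝ)⁻¹) ^ 2 * ∑ _i : Fin B, N ^ 2 := by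
          gcongr with i; exact h2 i
      _ = N ^ 2 / B := by simp; field_simp
  rw [variance_eq_integral hZLp.aestronglyMeasurable.aemeasurable, hZmean] at hvar
  have hint : Integrable (fun ω => (Z ω - e) ^ 2) P := (hZLp.sub (memLp_const e)).integrable_sq
  -- Expanding `√B * (|Z ω - e| - 1 / √B) ^ 2 ≥ 0` replaces Cauchy–Schwarz. The weight `√B` balances
  -- the terms: with variance at most `N ^ 2 / B`, both integrate to order `1 / √B`.
  have hpt (ω) : |Z ω - e| ≤ √B * (Z ω - e) ^ 2 + 1 / √B := by
    rw [← sq_abs (Z ω - e)]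
    have h : √(B : ℝ) * (1 / √B) = 1 := by field_simp
    have h0 : 0 < 1 / √(B : ℝ) := by positivity
    set u := 1 / √(B : ℝ)
    have h5 : √(B : ℝ) * (|Z ω - e| - u) ^ 2 =
      √(B : ℝ) * |Z ω - e| ^ 2 - 2 * |Z ω - e| * (√(B : ℝ) * u) + u * (√(B : ℝ) * u) := by ring
    rw [h] at h5
    have h6 : 0 ≤ √(B : ℝ) * (|Z ω - e| - u) ^ 2 := by positivity
    linarith [abs_nonneg (Z ω - e)]
  calc ∫⁻ ω, ENNReal.ofReal |Z ω - e| ∂P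
      ≤ ∫⁻ ω, ENNReal.ofReal (√B * (Z ω - e) ^ 2 + 1 / √B) ∂P :=
        lintegral_mono fun ω => ENNReal.ofReal_le_ofReal (hpt ω)
    _ = ENNReal.ofReal (∫ ω, (√B * (Z ω - e) ^ 2 + 1 / √B) ∂P) :=
        (ofReal_integral_eq_lintegral_ofReal ((hint.const_mul _).add (integrable_const _))
          (ae_of_all _ fun ω => (abs_nonneg _).trans (hpt ω))).symm
    _ ≤ ENNReal.ofReal ((N ^ 2 + 1) / √B) := by
        refine ENNReal.ofReal_le_ofReal ?_
        rw [integral_add (hint.const_mul _) (integrable_const _), integral_const_mul,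
          integral_const, add_div]
        simp only [probReal_univ, one_smul, add_le_add_iff_right]
        refine (mul_le_mul_of_nonneg_left hvar hs.le).trans_eq ?_
        rw [← mul_div_assoc, div_eq_div_iff hB'.ne' hs.ne']
        linear_combination N ^ 2 * hss

/-! ### Mean and expected diagrams -/

section Subsampling

variable (𝕜 : Type*) [Field 𝕜] (k : ℕ) {m : ℕ} {X : Finset (EuclideanSpace ℝ (Fin m))}

/-- The multiplicity of `x` in the diagram of a sample. -/
noncomputable def sampleMultiplicity {n : ℕ} (x : HalfPlane) (s : Fin n → X) : ℕ :=
  diagramMultiplicity 𝕜 k (Set.range fun i => (s i : EuclideanSpace ℝ (Fin m))) x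

lemma range_sample_subset {n : ℕ} (s : Fin n → X) :
    (Set.range fun i => (s i : EuclideanSpace ℝ (Fin m))) ⊆ X :=
  Set.range_subset_iff.2 fun i => (s i).2

lemma sampleMultiplicity_le {n : ℕ} (x : HalfPlane) (s : Fin n → X) :
    sampleMultiplicity 𝕜 k x s ≤ 2 ^ X.card :=
  diagramMultiplicity_le 𝕜 k (range_sample_subset s) x

lemma sampleDiagram_eq_sum {n : ℕ} (s : Fin n → X) :
    sampleDiagram 𝕜 k s =
      ∑ x ∈ criticalPairs X, (sampleMultiplicity 𝕜 k x s : ℝ≥0∞) • Measure.dirac x :=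
  persistenceDiagram_eq_sum 𝕜 k (range_sample_subset s)

lemma meanDiagram_eq_sum {n B : ℕ} (hB : 0 < B) (s : Fin B → Fin n → X) :
    meanDiagram 𝕜 k s = ∑ x ∈ criticalPairs X,
      ENNReal.ofReal ((B : ℝ)⁻¹ * ∑ i, (sampleMultiplicity 𝕜 k x (s i) : ℝ)) •
        Measure.dirac x := by
  have hB' : (0 : ℝ) < B := Nat.cast_pos.2 hB
  simp only [meanDiagram, sampleDiagram_eq_sum]
  rw [Finset.sum_comm, Finset.smul_sum]
  refine Finset.sum_congr rfl fun x _ => ?_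
  rw [← Finset.sum_smul, smul_smul, ENNReal.ofReal_mul (by positivity),
    ENNReal.ofReal_inv_of_pos hB', ENNReal.ofReal_natCast,
    ENNReal.ofReal_sum_of_nonneg fun i _ => Nat.cast_nonneg _]
  simp only [ENNReal.ofReal_natCast]

/-- The sample space is finite, so integrability is automatic. -/
lemma integrable_sampleMultiplicity {n : ℕ} (μ : Measure (Fin n → X)) [IsFiniteMeasure μ]
    (x : HalfPlane) : Integrable (fun s => (sampleMultiplicity 𝕜 k x s : ℝ)) μ :=
  Integrable.of_finite

lemma expectedDiagram_eq_sum (π : Measure X) [IsProbabilityMeasure π] (n : ℕ) :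
    expectedDiagram 𝕜 k π n = ∑ x ∈ criticalPairs X,
      ENNReal.ofReal (∫ s, (sampleMultiplicity 𝕜 k x s : ℝ) ∂Measure.pi fun _ : Fin n => π) •
        Measure.dirac x := by
  ext A hA
  rw [expectedDiagram_apply 𝕜 k π n hA, Measure.finsetSum_apply]
  simp only [sampleDiagram_eq_sum, Measure.finsetSum_apply, Measure.smul_apply, smul_eq_mul]
  rw [lintegral_finsetSum _ fun _ _ => Measurable.of_discrete]
  refine Finset.sum_congr rfl fun x _ => ?_
  rw [lintegral_mul_const _ Measurable.of_discrete,
    ofReal_integral_eq_lintegral_ofReal (integrable_sampleMultiplicity 𝕜 k _ x)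
      (ae_of_all _ fun s => Nat.cast_nonneg _)]
  simp only [ENNReal.ofReal_natCast]

end Subsampling

theorem mainTheorem4 {m : ℕ} (X : Finset (EuclideanSpace ℝ (Fin m))) (p : ℝ) (hp : 1 ≤ p) :
    ∃ C : ℝ, 0 < C ∧
      ∀ (𝕜 : Type*) [Field 𝕜] (k : ℕ) (π : Measure X) [IsProbabilityMeasure π] (n B : ℕ),
        0 < n → 0 < B →
        ∀ (Ω : Type*) [MeasurableSpace Ω] (P : Measure Ω) [IsProbabilityMeasure P]
          (S : Fin B → Ω → Fin n → X),
          (∀ i, HasLaw (S i) (Measure.pi fun _ : Fin n => π) P) → iIndepFun S P →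
          ∫⁻ ω, OTDist p (ENNReal.ofReal p) (meanDiagram 𝕜 k fun i => S i ω)
              (expectedDiagram 𝕜 k π n) ^ p ∂P ≤ ENNReal.ofReal (C / √B) := by
  set N : ℝ := 2 ^ X.card
  set M : ℝ := ∑ x ∈ criticalPairs X, diagonalCost p x
  have hM : 0 ≤ M := Finset.sum_nonneg fun x _ => diagonalCost_nonneg hp x
  -- The final `+ 1` keeps the constant positive when `M = 0`, for instance when there are no
  -- critical pairs.
  refine ⟨M * (N ^ 2 + 1) + 1, by positivity, ?_⟩
  intro 𝕜 _ k π _ n B _ hB Ω _ P _ S hlaw hindep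
  let Y (x : HalfPlane) (i : Fin B) (ω : Ω) : ℝ := sampleMultiplicity 𝕜 k x (S i ω)
  let e (x : HalfPlane) : ℝ :=
    ∫ s, (sampleMultiplicity 𝕜 k x s : ℝ) ∂Measure.pi fun _ : Fin n => π
  have he (x) : 0 ≤ e x := integral_nonneg fun s => Nat.cast_nonneg _
  have hYmeas (x i) : AEMeasurable (Y x i) P :=
    (Measurable.of_discrete (f := fun s : Fin n → X => (sampleMultiplicity 𝕜 k x s : ℝ)))
      |>.comp_aemeasurable (hlaw i).aemeasurable
  have hYle (x i ω) : Y x i ω ≤ N := by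
    have h : ((sampleMultiplicity 𝕜 k x (S i ω) : ℕ) : ℝ) ≤ ((2 ^ X.card : ℕ) : ℝ) :=
      Nat.cast_le.2 (sampleMultiplicity_le 𝕜 k x (S i ω))
    simpa [Y, N] using h
  have hdev (x : HalfPlane) : ∫⁻ ω, ENNReal.ofReal |(B : ℝ)⁻¹ * ∑ i, Y x i ω - e x| ∂P ≤
      ENNReal.ofReal ((N ^ 2 + 1) / √B) := by
    refine lintegral_abs_mean_sub_le hB (hYmeas x)
      (fun i ω => ⟨Nat.cast_nonneg _, hYle x i ω⟩)
      (fun i => ?_) ?_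
    · exact (hlaw i).integral_comp (integrable_sampleMultiplicity 𝕜 k _ x).aestronglyMeasurable
    · exact hindep.comp (fun _ s => (sampleMultiplicity 𝕜 k x s : ℝ))
        fun _ => Measurable.of_discrete
  calc _ ≤ ∫⁻ ω, ∑ x ∈ criticalPairs X, ENNReal.ofReal (diagonalCost p x) *
          ENNReal.ofReal |(B : ℝ)⁻¹ * ∑ i, Y x i ω - e x| ∂P := by
        refine lintegral_mono fun ω => ?_
        rw [meanDiagram_eq_sum 𝕜 k hB, expectedDiagram_eq_sum]
        refine (OTDist_rpow_le hp _ (fun x _ => ENNReal.ofReal_ne_top)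
          fun x _ => ENNReal.ofReal_ne_top).trans_eq (Finset.sum_congr rfl fun x _ => ?_)
        rw [ENNReal.sub_add_sub_eq_ofReal_abs (by positivity) (he x)]
    _ = ∑ x ∈ criticalPairs X, ENNReal.ofReal (diagonalCost p x) *
          ∫⁻ ω, ENNReal.ofReal |(B : ℝ)⁻¹ * ∑ i, Y x i ω - e x| ∂P := by
        have hmeas (x) : AEMeasurable
            (fun ω => ENNReal.ofReal |(B : ℝ)⁻¹ * ∑ i, Y x i ω - e x|) P := by
          have := hYmeas x
          fun_prop
        rw [lintegral_finsetSum' _ fun x _ => (hmeas x).const_mul _]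
        exact Finset.sum_congr rfl fun x _ => lintegral_const_mul'' _ (hmeas x)
    _ ≤ ∑ x ∈ criticalPairs X, ENNReal.ofReal (diagonalCost p x) *
          ENNReal.ofReal ((N ^ 2 + 1) / √B) := by
        gcongr with x
        exact hdev x
    _ = ENNReal.ofReal (M * ((N ^ 2 + 1) / √B)) := by
        rw [← Finset.sum_mul, ENNReal.ofReal_mul hM,
          ENNReal.ofReal_sum_of_nonneg fun x _ => diagonalCost_nonneg hp x]
    _ ≤ ENNReal.ofReal ((M * (N ^ 2 + 1) + 1) / √B) := by
        rw [← mul_div_assoc]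
        gcongr
        linarith
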